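/- Let $d, L, w_1,\dots,w_L \ge 1$ be integers, put $w_0 := d$ and $w_{L+1} := 1$, let $K \subset \mathbb{R}^d$ be nonempty and compact, and let $C(K)$ be the space of continuous functions $K\to\mathbb{R}$ with the maximum norm. Let $\sigma_1,\dots,\sigma_L \colon \mathbb{R}\to\mathbb{R}$ be continuous functions, none of which is a polynomial. Let $D$ be the space of all $\alpha = \{(A_i,b_i)\}_{i=1}^{L+1}$ with $A_i \in \mathbb{R}^{w_i\times w_{i-1}}$, $b_i \in \mathbb{R}^{w_i}$, equipped with the Euclidean norm of all entries, so that $D \cong \mathbb{R}^m$ with $m := \sum_{i=1}^{L+1} w_i(w_{i-1}+1)$. For $\alpha \in D$ let $\Psi(\alpha) \in C(K)$ be the restriction to $K$ of the network function $$x \mapsto \psi(\alpha,x) := \big(\varphi_{L+1}\circ\dots\circ\varphi_1\big)(x),\qquad \varphi_i(z) := \sigma_i(A_i z + b_i)\ (1\le i\le L),\quad \varphi_{L+1}(z) := A_{L+1}z+b_{L+1},$$ where $\sigma_i$ acts componentwise. Let $y_T \in C(K)$ and $\mathcal{L}\colon C(K)\times C(K)\to\mathbb{R}$, and for $c\in\mathbb{R}$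 let $z_c \in C(K)$ be the constant function with value $c$. Assume that: i) $\sigma_j$ is constant on a nonempty open interval for some $j\in\{1,\dots,L\}$; ii) $y_T$ is not constant on $K$; iii) for every $v\in C(K)$ with $v\ne y_T$, the function $\mathcal{L}(\cdot,y_T)$ is Gâteaux differentiable at $v$ with nonzero derivative, that is, there is a nonzero continuous linear functional $\ell_v$ on $C(K)$ with $\lim_{s\to 0^+} \frac{\mathcal{L}(v+sh,y_T)-\mathcal{L}(v,y_T)}{s} = \ell_v(h)$ for all $h\in C(K)$; iv) the problem of minimizing $\mathcal{L}(z_c,y_T)$ over $c\in\mathbb{R}$ has a global solution. Then there exists a set $E\subset D$ of Hausdorff dimension $\dim_{\mathcal H}(E)\ge m-1$ such that every element of $E$ is a spurious local minimum (a local minimum that is not a global minimum) of the training problem of minimizing $\mathcal{L}(\Psi(\alpha),y_T)$ over $\alpha\in D$, and such that $$\mathcal{L}(\Psi(\alpha),y_T) = \min_{c\in\mathbb{R}}\mathcal{L}(z_c,y_T)\qquad\text{for all }\alpha\in E.$$ -/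

import Mathlib

open scoped ENNReal Matrix

namespace SpuriousMinima

/-- Layer widths `w₀ = d`, `w₁, …, w_L` (the entries of `w`), `w_{L+1} = 1` of a network with `L`
hidden layers. The values at indices above `L + 1` play no role. -/
def layerWidth (d : ℕ) {L : ℕ} (w : Fin L → ℕ) : ℕ → ℕ
  | 0 => d
  | i + 1 => if h : i < L then w ⟨i, h⟩ else 1

theorem layerWidth_output (d : ℕ) {L : ℕ} (w : Fin L → ℕ) : layerWidth d w (L + 1) = 1 := by
  simp [layerWidth]

/-- Index set of the entries of all weights and biases. For `i : Fin (L + 1)`, which stands for the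
`(i + 1)`-st affine map, the left summand indexes the entries of the weight matrix
`A_{i+1} ∈ ℝ^{w_{i+1} × w_i}` and the right summand those of the bias `b_{i+1} ∈ ℝ^{w_{i+1}}`. -/
abbrev ParamIndex (d : ℕ) {L : ℕ} (w : Fin L → ℕ) : Type :=
  Σ i : Fin (L + 1),
    (Fin (layerWidth d w (i + 1)) × Fin (layerWidth d w i)) ⊕ Fin (layerWidth d w (i + 1))

/-- The parameter space `D` of the network, with the Euclidean norm of all entries. -/
abbrev ParamSpace (d : ℕ) {L : ℕ} (w : Fin L → ℕ) : Type :=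
  EuclideanSpace ℝ (ParamIndex d w)

/-- The number of parameters `m = w_{L+1} (w_L + 1) + … + w₁ (w₀ + 1)`. -/
def paramCount (d : ℕ) {L : ℕ} (w : Fin L → ℕ) : ℕ :=
  ∑ i : Fin (L + 1), layerWidth d w (i + 1) * (layerWidth d w i + 1)

theorem finrank_paramSpace (d : ℕ) {L : ℕ} (w : Fin L → ℕ) :
    Module.finrank ℝ (ParamSpace d w) = paramCount d w := by
  simp [ParamSpace, ParamIndex, paramCount, mul_add]

/-- The weight matrix of the `(i + 1)`-st affine map. -/
def weight {d L : ℕ} {w : Fin L → ℕ} (α : ParamSpace d w) (i : Fin (L + 1)) :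
    Matrix (Fin (layerWidth d w (i + 1))) (Fin (layerWidth d w i)) ℝ :=
  Matrix.of fun j k => α ⟨i, Sum.inl (j, k)⟩

/-- The bias vector of the `(i + 1)`-st affine map. -/
def bias {d L : ℕ} {w : Fin L → ℕ} (α : ParamSpace d w) (i : Fin (L + 1)) :
    Fin (layerWidth d w (i + 1)) → ℝ :=
  fun j => α ⟨i, Sum.inr j⟩

/-- The `(i + 1)`-st affine map `z ↦ A_{i+1} z + b_{i+1}`. -/
def affineLayer {d L : ℕ} {w : Fin L → ℕ} (α : ParamSpace d w) (i : Fin (L + 1))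
    (z : Fin (layerWidth d w i) → ℝ) : Fin (layerWidth d w (i + 1)) → ℝ :=
  weight α i *ᵥ z + bias α i

/-- The output of the first `i ≤ L` hidden layers at the input `x`; each hidden layer applies its
affine map and then its activation function to every component. For `i = 0` this is `x`. -/
def hiddenOutput {d L : ℕ} {w : Fin L → ℕ} (σ : Fin L → C(ℝ, ℝ)) (α : ParamSpace d w)
    (x : EuclideanSpace ℝ (Fin d)) : (i : ℕ) → i ≤ L → Fin (layerWidth d w i) → ℝ
  | 0, _ => fun k : Fin d => x k
  | i + 1, h => fun k =>
      σ ⟨i, h⟩ (affineLayer α ⟨i, Nat.lt_succ_of_lt h⟩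
        (hiddenOutput σ α x i (Nat.le_of_succ_le h)) k)

/-- The network function `ψ(α, x)`: all hidden layers followed by the last affine map, whose target
`ℝ^{w_{L+1}} = ℝ^1` is read as `ℝ`. -/
def network {d L : ℕ} {w : Fin L → ℕ} (σ : Fin L → C(ℝ, ℝ)) (α : ParamSpace d w)
    (x : EuclideanSpace ℝ (Fin d)) : ℝ :=
  affineLayer α (Fin.last L) (hiddenOutput σ α x L le_rfl)
    ⟨0, (layerWidth_output d w).symm ▸ Nat.one_pos⟩

theorem continuous_affineLayer {d L : ℕ} {w : Fin L → ℕ} (α : ParamSpace d w) (i : Fin (L + 1)) :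
    Continuous (affineLayer α i) := by
  unfold affineLayer
  fun_prop

theorem continuous_hiddenOutput {d L : ℕ} {w : Fin L → ℕ} (σ : Fin L → C(ℝ, ℝ))
    (α : ParamSpace d w) (i : ℕ) (h : i ≤ L) :
    Continuous fun x => hiddenOutput σ α x i h := by
  induction i with
  | zero =>
    refine continuous_pi fun k => ?_
    exact (EuclideanSpace.proj (𝕜 := ℝ) (ι := Fin d) k).continuous
  | succ i ih =>
    refine continuous_pi fun k => (σ ⟨i, h⟩).continuous.comp ?_
    exact (continuous_apply k).comp ((continuous_affineLayer α _).comp (ih _))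

theorem continuous_network {d L : ℕ} {w : Fin L → ℕ} (σ : Fin L → C(ℝ, ℝ))
    (α : ParamSpace d w) : Continuous (network σ α) :=
  (continuous_apply _).comp
    ((continuous_affineLayer α _).comp (continuous_hiddenOutput σ α L le_rfl))

/-- The operator `Ψ : D → C(K)`, `Ψ(α) = ψ(α, ·)` restricted to `K`. -/
def networkMap {d L : ℕ} {w : Fin L → ℕ} (σ : Fin L → C(ℝ, ℝ))
    (K : Set (EuclideanSpace ℝ (Fin d))) (α : ParamSpace d w) : C(K, ℝ) :=
  ⟨fun x => network σ α x, (continuous_network σ α).comp continuous_subtype_val⟩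

/-- `F` is Gâteaux differentiable at `v` with derivative the continuous linear functional `F'`:
every one-sided directional derivative exists and is given by `F'`. -/
def HasGateauxDerivAt {X : Type*} [AddCommGroup X] [Module ℝ X] [TopologicalSpace X]
    (F : X → ℝ) (F' : X →L[ℝ] ℝ) (v : X) : Prop :=
  ∀ h : X, Filter.Tendsto (fun s : ℝ => (F (v + s • h) - F v) / s)
    (nhdsWithin 0 (Set.Ioi 0)) (nhds (F' h))

/-- A local minimum that is not a global minimum. -/
def IsSpuriousLocalMin {X : Type*} [TopologicalSpace X] (f : X → ℝ) (a : X) : Prop :=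
  IsLocalMin f a ∧ ¬ ∀ x, f a ≤ f x

/-- The function `σ` is given by a polynomial. -/
def IsPolynomialFunction (σ : ℝ → ℝ) : Prop :=
  ∃ p : Polynomial ℝ, ∀ t, σ t = p.eval t

end SpuriousMinima

/-! Let `U` be the set of parameters for which all preactivations of layer `j` on `K` lie in the
segment where its activation is constant. `U` is open since `K` is compact, and on `U` the network
is constant on `K`. So every point of `U` whose constant is the optimal `cbar` is a local minimum;
these points form `E`. Adjusting the output bias moves any point of `U` into `E`, so the projection
forgetting that bias maps `E` onto a nonempty open subset of an (m-1)-dimensional space. It is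
Lipschitz, which bounds `dimH E` from below (`card_sub_one_le_dimH`).

Spuriousness: the target is not constant, so the loss has a nonzero derivative `F'` at the constant
`cbar`. If some network `h` has `F' h ≠ 0`, the loss drops along `cbar + s h`, which is again a
network (`exists_networkMap_lt_const`).

Such an `h` exists because a functional `ℓ` killing all networks is zero
(`eq_zero_of_forall_networkMap`). Networks with one effective neuron per layer suffice. If `ℓ` kills
`σ (s g + t)` for all `s`, `t`, then, for smooth `σ`, differentiating `n` times in `s` at `0` gives
`σ⁽ⁿ⁾(t) ℓ(gⁿ) = 0`. Mollification extends this to continuous `σ`: either `ℓ(gⁿ) = 0` or `σ` is a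
polynomial. Taking `n = 1` peels off layers; at the input, `ℓ` kills all powers of linear forms,
hence their exponentials, and Stone–Weierstrass finishes. -/

namespace SpuriousMinima

open MeasureTheory Filter Topology ContinuousLinearMap
open scoped Convolution

/-! ### Polynomials via vanishing derivatives and pointwise limits -/

section Univariate

/-- A smooth function with vanishing `n`-th derivative is a polynomial of degree less than `n`. -/
theorem exists_polynomial_of_iteratedDeriv_eq_zero (n : ℕ) (f : ℝ → ℝ) (hf : ContDiff ℝ n f)
    (h : ∀ t, iteratedDeriv n f t = 0) :
    ∃ p : Polynomial ℝ, p.degree < n ∧ ∀ t, f t = p.eval t := by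
  induction n generalizing f with
  | zero => exact ⟨0, by simp, fun t => by simpa using h t⟩
  | succ n ih =>
    have hf' : ContDiff ℝ n (deriv f) := by
      rw [Nat.cast_add, Nat.cast_one] at hf
      exact (contDiff_succ_iff_deriv.1 hf).2.2
    obtain ⟨q, hq, hfq⟩ := ih (deriv f) hf' fun t => by
      simpa [iteratedDeriv_succ'] using h t
    have hdf : Differentiable ℝ f := hf.differentiable (by simp)
    set P : Polynomial ℝ := ∑ i ∈ Finset.range n,
      Polynomial.monomial (i + 1) (q.coeff i / (i + 1)) with hP
    have hPd : P.derivative = q := by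
      have hqs : q = ∑ i ∈ Finset.range n, Polynomial.monomial i (q.coeff i) := by
        ext i
        simp only [Polynomial.finsetSum_coeff, Polynomial.coeff_monomial,
          Finset.sum_ite_eq', Finset.mem_range]
        split_ifs with hi
        · rfl
        · exact Polynomial.coeff_eq_zero_of_degree_lt
            (hq.trans_le (by exact_mod_cast not_lt.1 hi))
      conv_rhs => rw [hqs]
      simp only [hP, Polynomial.derivative_sum, Polynomial.derivative_monomial]
      refine Finset.sum_congr rfl fun i _ => ?_
      congr 1
      have : (i : ℝ) + 1 ≠ 0 := by positivity
      push_cast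
      field_simp
    refine ⟨P + Polynomial.C (f 0 - P.eval 0), ?_, fun t => ?_⟩
    · refine (Polynomial.degree_add_le _ _).trans_lt (max_lt ?_ ?_)
      · refine (Polynomial.degree_sum_le _ _).trans_lt ?_
        rw [Finset.sup_lt_iff (by exact_mod_cast WithBot.bot_lt_coe _)]
        intro i hi
        refine (Polynomial.degree_monomial_le _ _).trans_lt ?_
        have := Finset.mem_range.1 hi
        exact_mod_cast Nat.succ_lt_succ this
      · refine Polynomial.degree_C_le.trans_lt ?_
        exact_mod_cast n.succ_pos
    · have hd : ∀ t, HasDerivAt (fun t => f t - P.eval t) 0 t := fun t => by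
        have := (hdf t).hasDerivAt.sub (P.hasDerivAt t)
        rwa [hPd, hfq, sub_self] at this
      have := is_const_of_deriv_eq_zero (fun t => (hd t).differentiableAt)
        (fun t => (hd t).deriv) t 0
      simp only [Polynomial.eval_add, Polynomial.eval_C]
      linarith

/-- Pointwise limits of polynomials of degree less than `n` are polynomials. -/
theorem isPolynomialFunction_of_tendsto (n : ℕ) (p : ℕ → Polynomial ℝ)
    (hp : ∀ k, (p k).degree < n) (f : ℝ → ℝ)
    (h : ∀ t, Tendsto (fun k => (p k).eval t) atTop (𝓝 (f t))) : IsPolynomialFunction f := by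
  have hinj : Set.InjOn (fun i : ℕ => (i : ℝ)) (Finset.range n) := Nat.cast_injective.injOn
  refine ⟨Lagrange.interpolate (Finset.range n) (fun i : ℕ => (i : ℝ)) fun i => f i, fun t => ?_⟩
  refine tendsto_nhds_unique (h t) ?_
  -- Each `p k` is recovered from its values at the nodes 0, …, n-1 with weights independent of `k`,
  -- so convergence at the nodes determines the limit.
  have : ∀ k, (p k).eval t = ∑ i ∈ Finset.range n,
      (p k).eval (i : ℝ) * (Lagrange.basis (Finset.range n) (fun i : ℕ => (i : ℝ)) i).eval t := by
    intro k
    conv_lhs => rw [Lagrange.eq_interpolate hinj (f := p k) (by simpa using hp k)]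
    simp [Lagrange.interpolate_apply, Polynomial.eval_finsetSum]
  simp only [this, Lagrange.interpolate_apply, Polynomial.eval_finsetSum, Polynomial.eval_mul,
    Polynomial.eval_C]
  exact tendsto_finsetSum _ fun i _ => (h i).mul_const _

end Univariate

/-! ### Functionals annihilating ridge-type functions -/

section Annihilator

variable {X : Type*} [TopologicalSpace X]

/-- The function `x ↦ u (s * g x + t)`. -/
def affineSubst (u : C(ℝ, ℝ)) (g : C(X, ℝ)) (s t : ℝ) : C(X, ℝ) :=
  u.comp (s • g + ContinuousMap.const X t)

@[simp]
theorem affineSubst_apply (u : C(ℝ, ℝ)) (g : C(X, ℝ)) (s t : ℝ) (x : X) :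
    affineSubst u g s t x = u (s * g x + t) := rfl

variable [CompactSpace X]

/-- The derivative exists in the maximum norm, not only pointwise: the curve is the `C(X, ℝ)`-valued
integral of its continuous pointwise derivative. The factor `h` lets the lemma be iterated with `h =
g ^ k`. -/
theorem hasDerivAt_mul_affineSubst (u u' : C(ℝ, ℝ)) (hu : ∀ t, HasDerivAt u (u' t) t)
    (g h : C(X, ℝ)) (s t : ℝ) :
    HasDerivAt (fun s => h * affineSubst u g s t) (g * h * affineSubst u' g s t) s := by
  have hc : Continuous fun s => g * h * affineSubst u' g s t := by
    refine ContinuousMap.continuous_of_continuous_uncurry _ ?_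
    simp only [Function.uncurry_def, ContinuousMap.mul_apply, affineSubst_apply]
    fun_prop
  have hF : (fun s => h * affineSubst u g s t) = fun s =>
      (∫ r in (0 : ℝ)..s, g * h * affineSubst u' g r t) + h * affineSubst u g 0 t := by
    funext s
    ext x
    have h1 := (ContinuousMap.evalCLM ℝ x).intervalIntegral_comp_comm (μ := volume)
      (hc.intervalIntegrable 0 s)
    have h2 : ∫ r in (0 : ℝ)..s, (g * h * affineSubst u' g r t) x
        = h x * u (s * g x + t) - h x * u (0 * g x + t) := by
      refine intervalIntegral.integral_eq_sub_of_hasDerivAt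
        (f := fun r => h x * u (r * g x + t)) (fun r _ => ?_) ?_
      · have := ((hu (r * g x + t)).comp r
          (((hasDerivAt_id r).mul_const (g x)).add_const t)).const_mul (h x)
        refine this.congr_deriv ?_
        simp only [ContinuousMap.mul_apply, affineSubst_apply]
        ring
      · exact ((continuous_eval_const x).comp hc).intervalIntegrable _ _
    simp only [ContinuousMap.evalCLM_apply] at h1
    simp only [ContinuousMap.add_apply, ← h1, ContinuousMap.mul_apply, affineSubst_apply]
    simp only [ContinuousMap.mul_apply, affineSubst_apply] at h2
    rw [h2]
    ring
  rw [hF]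
  exact (intervalIntegral.integral_hasDerivAt_right (hc.intervalIntegrable _ _)
    hc.aestronglyMeasurable.stronglyMeasurableAtFilter hc.continuousAt).add_const _

/-- If a continuous functional annihilates all `f (s * g + t)` with `f` smooth, then it annihilates
`g ^ n`, unless the `n`-th derivative of `f` vanishes. -/
theorem pow_eq_zero_of_contDiff (ℓ : C(X, ℝ) →L[ℝ] ℝ) (g : C(X, ℝ)) (n : ℕ) (f : ℝ → ℝ)
    (hf : ContDiff ℝ n f)
    (h : ∀ s t, ℓ (affineSubst ⟨f, hf.continuous⟩ g s t) = 0)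
    {t : ℝ} (ht : iteratedDeriv n f t ≠ 0) : ℓ (g ^ n) = 0 := by
  have key : ∀ k (hk : k ≤ n), ∀ s, ℓ (g ^ k * affineSubst
      ⟨iteratedDeriv k f, hf.continuous_iteratedDeriv k (by exact_mod_cast hk)⟩ g s t) = 0 := by
    intro k
    induction k with
    | zero => intro _ s; simpa [iteratedDeriv_zero] using h s t
    | succ k ih =>
      intro hk s
      have hd := hasDerivAt_mul_affineSubst
        ⟨iteratedDeriv k f, hf.continuous_iteratedDeriv k (by exact_mod_cast (by omega : k ≤ n))⟩
        ⟨iteratedDeriv (k + 1) f, hf.continuous_iteratedDeriv (k + 1) (by exact_mod_cast hk)⟩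
        (fun t => by
          have := (hf.differentiable_iteratedDeriv k (by exact_mod_cast hk)) t
          simpa [iteratedDeriv_succ] using this.hasDerivAt) g (g ^ k) s t
      have h1 := ℓ.hasFDerivAt.comp_hasDerivAt s hd
      have h2 : (ℓ ∘ fun s => g ^ k * affineSubst ⟨iteratedDeriv k f,
          hf.continuous_iteratedDeriv k (by exact_mod_cast (by omega : k ≤ n))⟩ g s t)
          = fun _ => (0 : ℝ) := by
        funext s
        exact ih (by omega) s
      rw [h2] at h1
      rw [pow_succ']
      exact h1.unique (hasDerivAt_const s 0)
  -- At `s = 0` the substituted function is the constant `iteratedDeriv n f t`.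
  have h0 := key n le_rfl 0
  have : g ^ n * affineSubst ⟨iteratedDeriv n f, hf.continuous_iteratedDeriv n le_rfl⟩ g 0 t
      = iteratedDeriv n f t • g ^ n := by
    ext x
    simp [mul_comm]
  rw [this, map_smul, smul_eq_mul] at h0
  exact (mul_eq_zero.1 h0).resolve_left ht

/-- Annihilation of all `σ (s * g + t)` is inherited by the mollifications of `σ`. -/
theorem affineSubst_convolution_eq_zero (ℓ : C(X, ℝ) →L[ℝ] ℝ) (g : C(X, ℝ)) (σ : C(ℝ, ℝ))
    (h : ∀ s t, ℓ (affineSubst σ g s t) = 0) (φ : C(ℝ, ℝ)) (hφ : HasCompactSupport φ)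
    (f : C(ℝ, ℝ)) (hf : ∀ t, f t = ∫ r, φ r * σ (t - r)) (s t : ℝ) :
    ℓ (affineSubst f g s t) = 0 := by
  have hc : Continuous fun r => φ r • affineSubst σ g s (t - r) := by
    refine φ.continuous.smul (ContinuousMap.continuous_of_continuous_uncurry _ ?_)
    simp only [Function.uncurry_def, affineSubst_apply]
    fun_prop
  have hi : Integrable fun r => φ r • affineSubst σ g s (t - r) :=
    hc.integrable_of_hasCompactSupport hφ.smul_right
  have : affineSubst f g s t = ∫ r, φ r • affineSubst σ g s (t - r) := by
    ext x
    have h1 := (ContinuousMap.evalCLM ℝ x).integral_comp_comm hi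
    simp only [ContinuousMap.evalCLM_apply] at h1
    simp only [affineSubst_apply, hf, ← h1, ContinuousMap.smul_apply, smul_eq_mul, add_sub_assoc]
  rw [this, ← ℓ.integral_comp_comm hi]
  simp [h]

/-- A continuous functional that annihilates all `σ (s * g + t)` with `σ` not polynomial annihilates
all powers of `g`. -/
theorem pow_eq_zero_of_affineSubst (ℓ : C(X, ℝ) →L[ℝ] ℝ) (g : C(X, ℝ)) (σ : C(ℝ, ℝ))
    (hσ : ¬ IsPolynomialFunction σ) (h : ∀ s t, ℓ (affineSubst σ g s t) = 0) (n : ℕ) :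
    ℓ (g ^ n) = 0 := by
  by_contra hn
  -- Bumps with support shrinking to `0`, so that the mollifications `f k` converge pointwise to
  -- `σ`.
  let φ : ℕ → ContDiffBump (0 : ℝ) := fun k =>
    ⟨1 / (2 * ((k : ℝ) + 1)), 1 / ((k : ℝ) + 1), by positivity, by
      refine one_div_lt_one_div_of_lt (by positivity) ?_
      have : (0 : ℝ) < k + 1 := by positivity
      linarith⟩
  have hφ : Tendsto (fun k => (φ k).rOut) atTop (𝓝 0) := tendsto_one_div_add_atTop_nhds_zero_nat
  let f : ℕ → ℝ → ℝ := fun k => (φ k).normed volume ⋆[lsmul ℝ ℝ, volume] σ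
  have hf : ∀ k, ContDiff ℝ n (f k) := fun k =>
    (φ k).hasCompactSupport_normed.contDiff_convolution_left _ (φ k).contDiff_normed
      σ.continuous.locallyIntegrable
  have hz : ∀ k t, iteratedDeriv n (f k) t = 0 := by
    intro k t
    by_contra ht
    refine hn (pow_eq_zero_of_contDiff ℓ g n (f k) (hf k) (fun s t => ?_) ht)
    exact affineSubst_convolution_eq_zero ℓ g σ h ⟨_, (φ k).continuous_normed⟩
      (φ k).hasCompactSupport_normed _ (fun t => rfl) s t
  choose p hp hfp using fun k => exists_polynomial_of_iteratedDeriv_eq_zero n (f k) (hf k) (hz k)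
  refine hσ (isPolynomialFunction_of_tendsto n p hp σ fun t => ?_)
  simp only [← hfp]
  exact ContDiffBump.convolution_tendsto_right_of_continuous hφ σ.continuous t

theorem exp_eq_zero_of_pow_eq_zero (ℓ : C(X, ℝ) →L[ℝ] ℝ) (g : C(X, ℝ))
    (h : ∀ n, ℓ (g ^ n) = 0) : ℓ (NormedSpace.exp g) = 0 := by
  have := (NormedSpace.exp_series_hasSum_exp' (𝕂 := ℝ) g).mapL ℓ
  simp only [map_smul, h, smul_zero] at this
  exact this.unique hasSum_zero

theorem exp_apply (g : C(X, ℝ)) (x : X) : NormedSpace.exp g x = Real.exp (g x) := by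
  rw [Real.exp_eq_exp_ℝ]
  exact NormedSpace.map_exp (ContinuousMap.evalAlgHom ℝ ℝ x)
    (continuous_eval_const x) g

/-- A continuous functional that annihilates all powers of the elements of an additive group of
functions that separates points is zero. -/
theorem eq_zero_of_forall_pow_eq_zero (ℓ : C(X, ℝ) →L[ℝ] ℝ) (G : AddSubgroup C(X, ℝ))
    (hG : ∀ x y : X, x ≠ y → ∃ g ∈ G, g x ≠ g y) (h : ∀ g ∈ G, ∀ n, ℓ (g ^ n) = 0) :
    ℓ = 0 := by
  -- Since `exp (a + b) = exp a * exp b`, the exponentials form a monoid. The algebra they generate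
  -- is their linear span, so linearity alone shows that `ℓ` vanishes on it.
  let M : Submonoid C(X, ℝ) :=
    { carrier := NormedSpace.exp '' (G : Set C(X, ℝ))
      one_mem' := ⟨0, G.zero_mem, NormedSpace.exp_zero⟩
      mul_mem' := by
        rintro _ _ ⟨a, ha, rfl⟩ ⟨b, hb, rfl⟩
        exact ⟨a + b, G.add_mem ha hb, NormedSpace.exp_add⟩ }
  have hM : ∀ f ∈ M, ℓ f = 0 := by
    rintro _ ⟨a, ha, rfl⟩
    exact exp_eq_zero_of_pow_eq_zero ℓ a (h a ha)
  have hsub : ∀ f ∈ Algebra.adjoin ℝ (M : Set C(X, ℝ)), ℓ f = 0 := by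
    intro f hf
    rw [← Subalgebra.mem_toSubmodule, Algebra.adjoin_eq_span, Submonoid.closure_eq] at hf
    exact (Submodule.span_le.2 hM : _ ≤ LinearMap.ker (ℓ : C(X, ℝ) →ₗ[ℝ] ℝ)) hf
  have htop := ContinuousMap.subalgebra_topologicalClosure_eq_top_of_separatesPoints
    (Algebra.adjoin ℝ (M : Set C(X, ℝ))) (by
      intro x y hxy
      obtain ⟨g, hg, hgxy⟩ := hG x y hxy
      refine ⟨_, ⟨NormedSpace.exp g, Algebra.subset_adjoin ⟨g, hg, rfl⟩, rfl⟩, ?_⟩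
      simp only [exp_apply]
      exact fun he => hgxy (Real.exp_injective he))
  ext f
  have hf : f ∈ (Algebra.adjoin ℝ (M : Set C(X, ℝ))).topologicalClosure := by
    rw [htop]; trivial
  exact closure_minimal (t := {f | ℓ f = 0}) hsub (isClosed_eq ℓ.continuous continuous_const) hf

end Annihilator

/-! ### Dependence of the network on its parameters -/

section Network

variable {d L : ℕ} {w : Fin L → ℕ}

theorem affineLayer_apply (α : ParamSpace d w) (i : Fin (L + 1))
    (z : Fin (layerWidth d w i) → ℝ) (j : Fin (layerWidth d w (i + 1))) :
    affineLayer α i z j = ∑ k, α ⟨i, Sum.inl (j, k)⟩ * z k + α ⟨i, Sum.inr j⟩ := rfl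

theorem continuous_affineLayer_uncurry (i : Fin (L + 1)) :
    Continuous fun p : ParamSpace d w × (Fin (layerWidth d w i) → ℝ) =>
      affineLayer p.1 i p.2 := by
  refine continuous_pi fun j => ?_
  simp only [affineLayer_apply]
  fun_prop

theorem continuous_hiddenOutput_uncurry (σ : Fin L → C(ℝ, ℝ)) (i : ℕ) (h : i ≤ L) :
    Continuous fun p : ParamSpace d w × EuclideanSpace ℝ (Fin d) =>
      hiddenOutput σ p.1 p.2 i h := by
  induction i with
  | zero =>
    refine continuous_pi fun k => ?_
    exact (EuclideanSpace.proj (𝕜 := ℝ) (ι := Fin d) k).continuous.comp continuous_snd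
  | succ i ih =>
    refine continuous_pi fun k => (σ ⟨i, h⟩).continuous.comp ?_
    exact (continuous_apply k).comp
      ((continuous_affineLayer_uncurry _).comp (continuous_fst.prodMk (ih _)))

/-- The output of the first `n` layers depends only on the parameters of these layers. -/
theorem hiddenOutput_congr (σ : Fin L → C(ℝ, ℝ)) {α β : ParamSpace d w}
    (x : EuclideanSpace ℝ (Fin d)) (n : ℕ) (h : n ≤ L)
    (hαβ : ∀ p : ParamIndex d w, p.1.val < n → α p = β p) :
    hiddenOutput σ α x n h = hiddenOutput σ β x n h := by
  induction n with
  | zero => rfl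
  | succ n ih =>
    funext k
    simp only [hiddenOutput, affineLayer_apply,
      ih (Nat.le_of_succ_le h) fun p hp => hαβ p (hp.trans n.lt_succ_self)]
    rw [hαβ _ n.lt_succ_self]
    congr 2
    exact Finset.sum_congr rfl fun l _ => by rw [hαβ _ n.lt_succ_self]

/-- Inputs that are identified by some layer are identified by all later layers. -/
theorem hiddenOutput_eq_of_le (σ : Fin L → C(ℝ, ℝ)) (α : ParamSpace d w)
    {x y : EuclideanSpace ℝ (Fin d)} {i n : ℕ} (hin : i ≤ n) (hn : n ≤ L)
    (hxy : hiddenOutput σ α x i (hin.trans hn) = hiddenOutput σ α y i (hin.trans hn)) :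
    hiddenOutput σ α x n hn = hiddenOutput σ α y n hn := by
  induction n, hin using Nat.le_induction with
  | base => exact hxy
  | succ n hin ih =>
    funext k
    simp only [hiddenOutput, ih (Nat.le_of_succ_le hn) hxy]

/-- The parameters of the network `x ↦ s * ψ(α, x) + c`. -/
def affineOutput (α : ParamSpace d w) (s c : ℝ) : ParamSpace d w :=
  WithLp.toLp 2 fun p =>
    if p.1 = Fin.last L then s * α p + Sum.elim (fun _ => 0) (fun _ => c) p.2 else α p

theorem affineOutput_apply_of_ne (α : ParamSpace d w) (s c : ℝ) {p : ParamIndex d w}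
    (hp : p.1 ≠ Fin.last L) : affineOutput α s c p = α p := by
  simp [affineOutput, hp]

theorem affineOutput_weight (α : ParamSpace d w) (s c : ℝ) (q) :
    affineOutput α s c ⟨Fin.last L, Sum.inl q⟩ = s * α ⟨Fin.last L, Sum.inl q⟩ := by
  simp [affineOutput]

theorem affineOutput_bias (α : ParamSpace d w) (s c : ℝ) (q) :
    affineOutput α s c ⟨Fin.last L, Sum.inr q⟩ = s * α ⟨Fin.last L, Sum.inr q⟩ + c := by
  simp [affineOutput]

theorem hiddenOutput_affineOutput (σ : Fin L → C(ℝ, ℝ)) (α : ParamSpace d w) (s c : ℝ)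
    (x : EuclideanSpace ℝ (Fin d)) (n : ℕ) (h : n ≤ L) :
    hiddenOutput σ (affineOutput α s c) x n h = hiddenOutput σ α x n h :=
  hiddenOutput_congr σ x n h fun p hp => affineOutput_apply_of_ne α s c fun hl => by
    rw [hl, Fin.val_last] at hp
    omega

theorem network_affineOutput (σ : Fin L → C(ℝ, ℝ)) (α : ParamSpace d w) (s c : ℝ)
    (x : EuclideanSpace ℝ (Fin d)) :
    network σ (affineOutput α s c) x = s * network σ α x + c := by
  simp only [network, affineLayer_apply]
  rw [hiddenOutput_affineOutput]
  simp only [affineOutput_weight, affineOutput_bias, mul_add, Finset.mul_sum, mul_assoc, add_assoc]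

end Network

/-! ### Density of the span of networks, via a single neuron per layer -/

section Narrow

variable {d L : ℕ} (w : Fin L → ℕ)

/-- The weights of the affine maps `z ↦ s i * z 0 + t i` (`i > 0`) and
`x ↦ s 0 * ∑ k, a k * x k + t 0`. -/
def narrowWeight (a : Fin d → ℝ) (s : ℕ → ℝ) : (i : ℕ) → Fin (layerWidth d w i) → ℝ
  | 0, k => s 0 * a k
  | i + 1, k => if k.val = 0 then s (i + 1) else 0

/-- Parameters for which every layer computes copies of a single neuron, which uses only the first
neuron of the previous layer. -/
def narrowParam (a : Fin d → ℝ) (s t : ℕ → ℝ) : ParamSpace d w :=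
  WithLp.toLp 2 fun p => Sum.elim (fun q => narrowWeight w a s p.1 q.2) (fun _ => t p.1) p.2

/-- The linear function `x ↦ ∑ k, a k * x k` on `K`, additively in `a`. -/
def linearForm (K : Set (EuclideanSpace ℝ (Fin d))) : (Fin d → ℝ) →+ C(K, ℝ) where
  toFun a := ⟨fun x => ∑ k, a k * (x : EuclideanSpace ℝ (Fin d)) k, by fun_prop⟩
  map_zero' := by ext; simp
  map_add' a b := by ext; simp [add_mul, Finset.sum_add_distrib]

/-- The output of the first `i` layers of the network of width one. -/
def narrowMap (σ : Fin L → C(ℝ, ℝ)) (K : Set (EuclideanSpace ℝ (Fin d))) (a : Fin d → ℝ)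
    (s t : ℕ → ℝ) : (i : ℕ) → i ≤ L → C(K, ℝ)
  | 0, _ => linearForm K a
  | i + 1, h => affineSubst (σ ⟨i, h⟩) (narrowMap σ K a s t i (Nat.le_of_succ_le h)) (s i) (t i)

theorem layerWidth_succ_pos {w : Fin L → ℕ} (hw : ∀ i, 0 < w i) (i : ℕ) :
    0 < layerWidth d w (i + 1) := by
  simp only [layerWidth]
  split_ifs with h
  · exact hw _
  · exact one_pos

variable {w}

theorem narrowMap_congr (σ : Fin L → C(ℝ, ℝ)) (K : Set (EuclideanSpace ℝ (Fin d)))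
    (a : Fin d → ℝ) {s t s' t' : ℕ → ℝ} (i : ℕ) (h : i ≤ L)
    (hst : ∀ k < i, s k = s' k ∧ t k = t' k) :
    narrowMap σ K a s t i h = narrowMap σ K a s' t' i h := by
  induction i with
  | zero => rfl
  | succ i ih =>
    simp only [narrowMap, ih (Nat.le_of_succ_le h) fun k hk => hst k (hk.trans i.lt_succ_self),
      hst i i.lt_succ_self]

/-- Stating the invariant for the weighted sum entering the next layer treats the input, which uses
all coordinates, and the hidden layers, which use only neuron `0`, alike. -/
theorem sum_narrowWeight_mul_hiddenOutput (hw : ∀ i, 0 < w i) (σ : Fin L → C(ℝ, ℝ))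
    (K : Set (EuclideanSpace ℝ (Fin d))) (a : Fin d → ℝ) (s t : ℕ → ℝ) (x : K)
    (i : ℕ) (h : i ≤ L) :
    ∑ k, narrowWeight w a s i k * hiddenOutput σ (narrowParam w a s t) x i h k
      = s i * narrowMap σ K a s t i h x := by
  induction i with
  | zero =>
    change ∑ k : Fin d, s 0 * a k * (x : EuclideanSpace ℝ (Fin d)) k
      = s 0 * ∑ k, a k * (x : EuclideanSpace ℝ (Fin d)) k
    simp only [Finset.mul_sum, mul_assoc]
  | succ i ih =>
    rw [Finset.sum_eq_single ⟨0, layerWidth_succ_pos hw i⟩]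
    · have := ih (Nat.le_of_succ_le h)
      simp only [narrowWeight, if_true, hiddenOutput, affineLayer_apply, narrowMap,
        affineSubst_apply, ← this]
      rfl
    · intro k _ hk
      have : k.val ≠ 0 := fun h0 => hk (Fin.ext h0)
      simp [narrowWeight, this]
    · simp

theorem networkMap_narrowParam (hw : ∀ i, 0 < w i) (σ : Fin L → C(ℝ, ℝ))
    (K : Set (EuclideanSpace ℝ (Fin d))) (a : Fin d → ℝ) (s t : ℕ → ℝ) :
    networkMap σ K (narrowParam w a s t)
      = s L • narrowMap σ K a s t L le_rfl + ContinuousMap.const K (t L) := by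
  ext x
  have := sum_narrowWeight_mul_hiddenOutput hw σ K a s t x L le_rfl
  simp only [ContinuousMap.add_apply, ContinuousMap.smul_apply, smul_eq_mul, ← this]
  rfl

/-- The networks with nonpolynomial activation functions span a dense subspace of `C(K)`. -/
theorem eq_zero_of_forall_networkMap (hL : 0 < L) (hw : ∀ i, 0 < w i)
    {K : Set (EuclideanSpace ℝ (Fin d))} (hK : IsCompact K) (σ : Fin L → C(ℝ, ℝ))
    (hσ : ∀ i, ¬ IsPolynomialFunction (σ i)) (ℓ : C(K, ℝ) →L[ℝ] ℝ)
    (hℓ : ∀ α : ParamSpace d w, ℓ (networkMap σ K α) = 0) : ℓ = 0 := by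
  have : CompactSpace K := isCompact_iff_compactSpace.1 hK
  have step : ∀ i (h : i + 1 ≤ L), (∀ a s t, ℓ (narrowMap σ K a s t (i + 1) h) = 0) →
      ∀ a s t n, ℓ (narrowMap σ K a s t i (Nat.le_of_succ_le h) ^ n) = 0 := by
    intro i h hi a s t n
    -- The values `s i` and `t i` do not affect the first `i` layers, so they can be varied with the
    -- inner function fixed.
    refine pow_eq_zero_of_affineSubst ℓ _ (σ ⟨i, h⟩) (hσ _) (fun s' t' => ?_) n
    have := hi a (Function.update s i s') (Function.update t i t')
    rw [narrowMap, Function.update_self, Function.update_self] at this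
    rwa [narrowMap_congr σ K a i (s' := s) (t' := t)] at this
    exact fun k hk => by simp [hk.ne]
  have hlin : ∀ i (h : i + 1 ≤ L), ∀ a s t, ℓ (narrowMap σ K a s t (i + 1) h) = 0 := by
    intro i h
    refine Nat.decreasingInduction'
      (P := fun i => ∀ h : i ≤ L, ∀ a s t, ℓ (narrowMap σ K a s t i h) = 0)
      (fun k hk _ ih _ a s t => ?_) h (fun _ a s t => ?_) h
    · simpa using step k hk (ih hk) a s t 1
    -- Start at the top: scale `1` and bias `0` in the output layer expose the last hidden neuron.
    · have := hℓ (narrowParam w a (Function.update s L 1) (Function.update t L 0))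
      rw [networkMap_narrowParam hw, Function.update_self, Function.update_self, one_smul,
        narrowMap_congr σ K a L le_rfl (s' := s) (t' := t)
          (fun k hk => by simp [hk.ne])] at this
      have h0 : ContinuousMap.const K (0 : ℝ) = 0 := rfl
      rwa [h0, add_zero] at this
  refine eq_zero_of_forall_pow_eq_zero ℓ (linearForm K).range (fun x y hxy => ?_) ?_
  · have hne : (x : EuclideanSpace ℝ (Fin d)) ≠ y := fun h => hxy (Subtype.ext h)
    obtain ⟨k, hk⟩ : ∃ k, (x : EuclideanSpace ℝ (Fin d)) k ≠ (y : EuclideanSpace ℝ (Fin d)) k := by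
      by_contra! hall
      exact hne (PiLp.ext hall)
    refine ⟨_, ⟨Pi.single k 1, rfl⟩, ?_⟩
    simpa [linearForm, Pi.single_apply] using hk
  · rintro _ ⟨a, rfl⟩ n
    exact step 0 hL (hlin 0 hL) a 0 0 n

end Narrow

/-! ### Descent from constant functions -/

section Descent

variable {d L : ℕ} {w : Fin L → ℕ}

/-- At a point `v` of Gâteaux differentiability the value of `F` can be decreased along
every direction that the derivative does not annihilate. -/
theorem exists_lt_of_hasGateauxDerivAt {X : Type*} [AddCommGroup X] [Module ℝ X]
    [TopologicalSpace X] {F : X → ℝ} {F' : X →L[ℝ] ℝ} {v h : X} (hF : HasGateauxDerivAt F F' v)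
    (hh : F' h ≠ 0) : ∃ s : ℝ, F (v + s • h) < F v := by
  -- The multiple `-(F' h)` makes the directional derivative `-(F' h)²`, so the one-sided limit
  -- suffices.
  have hneg : F' (-(F' h) • h) < 0 := by
    rw [map_smul, smul_eq_mul, neg_mul, neg_lt_zero]
    exact mul_self_pos.2 hh
  obtain ⟨s, hs, hs0⟩ :=
    (((hF (-(F' h) • h)).eventually (gt_mem_nhds hneg)).and self_mem_nhdsWithin).exists
  refine ⟨s * -(F' h), ?_⟩
  rw [mul_smul]
  have := (div_lt_iff₀ hs0).1 hs
  linarith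

/-- No constant function is optimal among all network functions. -/
theorem exists_networkMap_lt_const (hL : 0 < L) (hw : ∀ i, 0 < w i)
    {K : Set (EuclideanSpace ℝ (Fin d))} (hK : IsCompact K) (σ : Fin L → C(ℝ, ℝ))
    (hσ : ∀ i, ¬ IsPolynomialFunction (σ i)) {F : C(K, ℝ) → ℝ} {F' : C(K, ℝ) →L[ℝ] ℝ} {c : ℝ}
    (hF : HasGateauxDerivAt F F' (ContinuousMap.const K c)) (hF' : F' ≠ 0) :
    ∃ α : ParamSpace d w, F (networkMap σ K α) < F (ContinuousMap.const K c) := by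
  obtain ⟨α, hα⟩ : ∃ α : ParamSpace d w, F' (networkMap σ K α) ≠ 0 := by
    by_contra! h
    exact hF' (eq_zero_of_forall_networkMap hL hw hK σ hσ F' h)
  obtain ⟨s, hs⟩ := exists_lt_of_hasGateauxDerivAt hF hα
  refine ⟨affineOutput α s c, ?_⟩
  convert hs using 2
  ext x
  change network σ _ _ = c + s * network σ _ _
  rw [network_affineOutput, add_comm]

end Descent

/-! ### The open set of constant networks and the dimension bound -/

section ConstantSegment

variable {d L : ℕ} {w : Fin L → ℕ}

/-- The parameters for which all preactivations of the `(j + 1)`-st layer on `K` lie in `(a, b)`. -/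
def segmentParams (σ : Fin L → C(ℝ, ℝ)) (K : Set (EuclideanSpace ℝ (Fin d))) (j : Fin L)
    (a b : ℝ) : Set (ParamSpace d w) :=
  {α | ∀ x ∈ K, ∀ k, affineLayer α ⟨j, j.2.trans L.lt_succ_self⟩
    (hiddenOutput σ α x j j.2.le) k ∈ Set.Ioo a b}

/-- The preactivations are jointly continuous in parameter and input, and compactness of `K` makes
the condition uniform near a given parameter. -/
theorem isOpen_segmentParams (σ : Fin L → C(ℝ, ℝ)) {K : Set (EuclideanSpace ℝ (Fin d))}
    (hK : IsCompact K) (j : Fin L) (a b : ℝ) :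
    IsOpen (segmentParams (w := w) σ K j a b) := by
  have hO : IsOpen {p : ParamSpace d w × EuclideanSpace ℝ (Fin d) |
      ∀ k, affineLayer p.1 ⟨j, j.2.trans L.lt_succ_self⟩
        (hiddenOutput σ p.1 p.2 j j.2.le) k ∈ Set.Ioo a b} := by
    have hc : Continuous fun p : ParamSpace d w × EuclideanSpace ℝ (Fin d) =>
        affineLayer p.1 ⟨j, j.2.trans L.lt_succ_self⟩ (hiddenOutput σ p.1 p.2 j j.2.le) :=
      (continuous_affineLayer_uncurry _).comp
        (continuous_fst.prodMk (continuous_hiddenOutput_uncurry σ j j.2.le))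
    have := (isOpen_set_pi (s := fun _ => Set.Ioo a b) Set.finite_univ
      fun _ _ => isOpen_Ioo).preimage hc
    simpa [Set.preimage, Set.mem_pi] using this
  refine isOpen_iff_mem_nhds.2 fun α hα => ?_
  exact hK.eventually_forall_of_forall_eventually fun x hx => hO.mem_nhds (hα x hx)

theorem segmentParams_nonempty (σ : Fin L → C(ℝ, ℝ)) (K : Set (EuclideanSpace ℝ (Fin d)))
    (j : Fin L) {a b : ℝ} (hab : a < b) : (segmentParams (w := w) σ K j a b).Nonempty := by
  refine ⟨WithLp.toLp 2 fun p => Sum.elim (fun _ => 0) (fun _ => (a + b) / 2) p.2,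
    fun x _ k => ?_⟩
  simp only [affineLayer_apply, Sum.elim_inl, Sum.elim_inr, zero_mul, Finset.sum_const_zero,
    zero_add, Set.mem_Ioo]
  constructor <;> linarith

theorem network_eq_of_mem_segmentParams (σ : Fin L → C(ℝ, ℝ))
    {K : Set (EuclideanSpace ℝ (Fin d))} {j : Fin L} {a b γ : ℝ}
    (hγ : ∀ t ∈ Set.Ioo a b, σ j t = γ) {α : ParamSpace d w}
    (hα : α ∈ segmentParams σ K j a b) {x y : EuclideanSpace ℝ (Fin d)} (hx : x ∈ K)
    (hy : y ∈ K) : network σ α x = network σ α y := by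
  have : hiddenOutput σ α x (j + 1) j.2 = hiddenOutput σ α y (j + 1) j.2 := by
    funext k
    exact (hγ _ (hα x hx k)).trans (hγ _ (hα y hy k)).symm
  rw [network, hiddenOutput_eq_of_le σ α j.2 le_rfl this, network]

/-- Layer `j` is hidden, while `affineOutput` changes only the output layer. -/
theorem affineOutput_mem_segmentParams {σ : Fin L → C(ℝ, ℝ)}
    {K : Set (EuclideanSpace ℝ (Fin d))} {j : Fin L} {a b : ℝ} {α : ParamSpace d w}
    (hα : α ∈ segmentParams σ K j a b) (s c : ℝ) :
    affineOutput α s c ∈ segmentParams σ K j a b := by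
  intro x hx k
  have h := hα x hx k
  rw [affineLayer_apply] at h ⊢
  have hne : (⟨j, j.2.trans L.lt_succ_self⟩ : Fin (L + 1)) ≠ Fin.last L :=
    fun h => j.2.ne (congrArg Fin.val h)
  rw [hiddenOutput_affineOutput, affineOutput_apply_of_ne _ _ _ (by exact hne)]
  simpa only [affineOutput_apply_of_ne α s c (p := ⟨_, Sum.inl _⟩) hne] using h

/-- The index of the output bias. -/
def outputBias (d : ℕ) {L : ℕ} (w : Fin L → ℕ) : ParamIndex d w :=
  ⟨Fin.last L, Sum.inr ⟨0, (layerWidth_output d w).symm ▸ Nat.one_pos⟩⟩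

theorem affineOutput_one_apply (α : ParamSpace d w) (c : ℝ) {p : ParamIndex d w}
    (hp : p ≠ outputBias d w) : affineOutput α 1 c p = α p := by
  obtain ⟨i, q⟩ := p
  by_cases hi : i = Fin.last L
  · subst hi
    rcases q with q | q
    · rw [affineOutput_weight, one_mul]
    · refine absurd ?_ hp
      -- The output layer has width one, hence a single bias.
      have hq : q.val < 1 := q.2.trans_eq (layerWidth_output d w)
      exact congrArg (fun r => (⟨Fin.last L, Sum.inr r⟩ : ParamIndex d w))
        (Fin.ext (Nat.lt_one_iff.1 hq))
  · exact affineOutput_apply_of_ne _ _ _ hi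

/-- If every point of a nonempty open set can be moved into `E` by changing one fixed coordinate,
then the Hausdorff dimension of `E` is at least the dimension of the space minus one. -/
theorem card_sub_one_le_dimH {ι : Type*} [Fintype ι] (i₀ : ι) {U E : Set (EuclideanSpace ℝ ι)}
    (hU : IsOpen U) (hne : U.Nonempty) (hE : ∀ α ∈ U, ∃ β ∈ E, ∀ i ≠ i₀, β i = α i) :
    (Fintype.card ι : ℝ≥0∞) - 1 ≤ dimH E := by
  classical
  let π : EuclideanSpace ℝ ι →ₗ[ℝ] ({i // i ≠ i₀} → ℝ) :=
    { toFun := fun α i => α i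
      map_add' := fun _ _ => rfl
      map_smul' := fun _ _ => rfl }
  have hsurj : Function.Surjective π := fun f =>
    ⟨WithLp.toLp 2 fun i => if h : i ≠ i₀ then f ⟨i, h⟩ else 0, by
      funext i; exact dif_pos i.2⟩
  have hlip : LipschitzWith 1 π := LipschitzWith.of_dist_le_mul fun α β => by
    rw [NNReal.coe_one, one_mul]
    refine (dist_pi_le_iff dist_nonneg).2 fun i => ?_
    rw [dist_eq_norm, dist_eq_norm]
    exact PiLp.norm_apply_le (α - β) i.1
  have hopen : IsOpen (π '' U) := π.isOpenMap_of_finiteDimensional hsurj U hU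
  have hsub : π '' U ⊆ π '' E := by
    rintro _ ⟨α, hα, rfl⟩
    obtain ⟨β, hβ, h⟩ := hE α hα
    exact ⟨β, hβ, funext fun i => h i i.2⟩
  have hdim : dimH (π '' U) = (Fintype.card ι - 1 : ℕ) := by
    rw [Real.dimH_of_nonempty_interior (by rw [hopen.interior_eq]; exact hne.image π)]
    simp [Fintype.card_subtype_compl]
  calc (Fintype.card ι : ℝ≥0∞) - 1 = dimH (π '' U) := by rw [hdim]; simp
    _ ≤ dimH (π '' E) := dimH_mono hsub
    _ ≤ dimH E := hlip.dimH_image_le E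

end ConstantSegment

end SpuriousMinima

/-- Spurious local minima for networks with an activation function that has a constant segment.
For compact `K`, the topology of `C(K, ℝ)` is that of the maximum norm. -/
theorem theorem3p2 (d L : ℕ) (hd : 0 < d) (hL : 0 < L)
    (w : Fin L → ℕ) (hw : ∀ i, 0 < w i)
    (K : Set (EuclideanSpace ℝ (Fin d))) (hK : IsCompact K) (hKne : K.Nonempty)
    (σ : Fin L → C(ℝ, ℝ)) (hσ : ∀ i, ¬ SpuriousMinima.IsPolynomialFunction (σ i))
    (hconst : ∃ j : Fin L, ∃ a b γ : ℝ, a < b ∧ ∀ t ∈ Set.Ioo a b, σ j t = γ)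
    (yT : C(K, ℝ)) (hyT : ¬ ∃ c : ℝ, ∀ x : K, yT x = c)
    (loss : C(K, ℝ) → C(K, ℝ) → ℝ)
    (hdiff : ∀ v : C(K, ℝ), v ≠ yT → ∃ F' : C(K, ℝ) →L[ℝ] ℝ,
      SpuriousMinima.HasGateauxDerivAt (fun u => loss u yT) F' v ∧ F' ≠ 0)
    (hbest : ∃ cbar : ℝ, ∀ c : ℝ,
      loss (ContinuousMap.const K cbar) yT ≤ loss (ContinuousMap.const K c) yT) :
    ∃ E : Set (SpuriousMinima.ParamSpace d w),
      (SpuriousMinima.paramCount d w : ℝ≥0∞) - 1 ≤ dimH E ∧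
      (∀ α ∈ E, SpuriousMinima.IsSpuriousLocalMin
        (fun β => loss (SpuriousMinima.networkMap σ K β) yT) α) ∧
      ∀ α ∈ E, IsLeast (Set.range fun c : ℝ => loss (ContinuousMap.const K c) yT)
        (loss (SpuriousMinima.networkMap σ K α) yT) := by
  obtain ⟨j, a, b, γ, hab, hγ⟩ := hconst
  obtain ⟨cbar, hcbar⟩ := hbest
  obtain ⟨x₀, hx₀⟩ := hKne
  have hmap : ∀ α ∈ SpuriousMinima.segmentParams (w := w) σ K j a b,
      SpuriousMinima.networkMap σ K α
        = ContinuousMap.const K (SpuriousMinima.network σ α x₀) := fun α hα =>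
    ContinuousMap.ext fun x =>
      SpuriousMinima.network_eq_of_mem_segmentParams σ hγ hα x.2 hx₀
  refine ⟨{α | α ∈ SpuriousMinima.segmentParams σ K j a b ∧
    SpuriousMinima.network σ α x₀ = cbar}, ?_, ?_, ?_⟩
  · have hcard : Fintype.card (SpuriousMinima.ParamIndex d w)
        = SpuriousMinima.paramCount d w := by
      rw [← SpuriousMinima.finrank_paramSpace, finrank_euclideanSpace]
    rw [← hcard]
    refine SpuriousMinima.card_sub_one_le_dimH (SpuriousMinima.outputBias d w)
      (SpuriousMinima.isOpen_segmentParams σ hK j a b)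
      (SpuriousMinima.segmentParams_nonempty σ K j hab) fun α hα =>
        ⟨SpuriousMinima.affineOutput α 1 (cbar - SpuriousMinima.network σ α x₀),
          ⟨SpuriousMinima.affineOutput_mem_segmentParams hα _ _, ?_⟩,
          fun i hi => SpuriousMinima.affineOutput_one_apply α _ hi⟩
    rw [SpuriousMinima.network_affineOutput]
    ring
  · rintro α ⟨hα, hαc⟩
    refine ⟨?_, fun hglob => ?_⟩
    -- Nearby parameters also realize constants, and `cbar` is optimal among constants.
    · filter_upwards [(SpuriousMinima.isOpen_segmentParams σ hK j a b).mem_nhds hα] with β hβ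
      rw [hmap α hα, hmap β hβ, hαc]
      exact hcbar _
    · have hv : ContinuousMap.const K cbar ≠ yT := fun h => hyT ⟨cbar, fun x => by simp [← h]⟩
      obtain ⟨F', hF, hF'⟩ := hdiff _ hv
      obtain ⟨β, hβ⟩ := SpuriousMinima.exists_networkMap_lt_const (w := w) hL hw hK σ hσ hF hF'
      have := hglob β
      simp only [hmap α hα, hαc] at this
      exact absurd hβ (not_lt.2 this)
  · rintro α ⟨hα, hαc⟩
    rw [hmap α hα, hαc]
    refine ⟨⟨cbar, rfl⟩, ?_⟩
    rintro _ ⟨c, rfl⟩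
    exact hcbar c
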